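/- Let $X$ be a reflexive real Banach space, $K\subset X$ closed and convex with $0\in K$, $X_j$ a real Banach space, and $Y$ a real normed space. For a locally Lipschitz function $j:X_j\to\mathbb R$ let $j^0(z;w)=\limsup_{y\to z,\ \lambda\downarrow0}\frac{j(y+\lambda w)-j(y)}{\lambda}$ be its Clarke directional derivative and $\partial j(z)=\{\xi\in X_j^*: j^0(z;w)\ge\langle\xi,w\rangle\ \forall w\in X_j\}$ its Clarke subdifferential. Assume: 1. $\gamma_j\in\mathcal L(X;X_j)$ and $\|\gamma_jv\|_{X_j}\le c_j\|v\|_X$ for all $v\in X$, with $c_j>0$. 2. $A:X\to X^*$ is Lipschitz continuous with constant $L_A>0$, and $\langle Av_1-Av_2,v_1-v_2\rangle\ge m_A\|v_1-v_2\|_X^2$ for all $v_1,v_2\in X$, with $m_A>0$. 3. $\varphi:Y\times K\times K\to\mathbb R$; for all $y\in Y$, $u\in K$ the function $\varphi(y,u,\cdot)$ is convex and lower semicontinuous on $K$; and there are $\alpha_\varphi,\beta_\varphi>0$ such that for all $y_1,y_2\in Y$ and $u_1,u_2,v_1,v_2\in K$ $$\varphi(y_1,u_1,v_2)-\varphi(y_1,u_1,v_1)+\varphi(y_2,u_2,v_1)-\varphi(y_2,u_2,v_2)\le\alpha_\varphi\|u_1-u_2\|_X\|v_1-v_2\|_X+\beta_\varphi\|y_1-y_2\|_Y\|v_1-v_2\|_X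 .$$ 4. $j:X_j\to\mathbb R$ is locally Lipschitz; there are $c_0,c_1\ge0$ with $\|\xi\|_{X_j^*}\le c_0+c_1\|z\|_{X_j}$ for all $z\in X_j$, $\xi\in\partial j(z)$; and there is $\alpha_j>0$ with $j^0(z_1;z_2-z_1)+j^0(z_2;z_1-z_2)\le\alpha_j\|z_1-z_2\|_{X_j}^2$ for all $z_1,z_2\in X_j$. 5. $j_c:X_j\to X_j^*$ is linear, $\|j_c(z)\|_{X_j^*}\le\alpha_c\|z\|_{X_j}$ for some constant $\alpha_c$, and $\langle j_c(z),z\rangle_{X_j}\ge\alpha_j\|z\|_{X_j}^2$ for all $z\in X_j$. 6. $f\in C(\mathbb R_+;X^*)$, $R\in\mathcal L(X;Y)$, $q\in C(\mathbb R_+\times\mathbb R_+;\mathcal L(X))$, $a_S\in X$; these define the history-dependent operator $(\mathcal Sv)(t)=R\big(\int_0^tq(t,s)v(s)\,ds+a_S\big)$. Let $T\ge0$, let $N\ge1$ be an integer, $k=T/N$, $t_n=nk$, $f_n=f(t_n)$, and for $v=(v_0,\dots,v_N)\in X^{N+1}$ and $1\le n\le N$ put $$\mathcal S^k_{n,L}v=R\Big(\tfrac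 k2q(t_n,t_0)v_0+k\sum_{i=1}^{n-1}q(t_n,t_i)v_i+\tfrac k2q(t_n,t_{n-1})v_{n-1}+a_S\Big).$$ Then, with no smallness condition relating $m_A,\alpha_\varphi,\alpha_j,\alpha_c,c_j$ and no restriction on $k$, the first-order semi-discrete scheme is uniquely solvable: for every starting value $u_0\in K$ there is exactly one sequence $(u^k_0,\dots,u^k_N)$ in $K$ with $u^k_0=u_0$ such that for every $n=1,\dots,N$ and every $v\in K$ $$\begin{aligned}&\langle Au^k_n,v-u^k_n\rangle+\varphi(\mathcal S^k_{n,L}u^k,u^k_{n-1},v)-\varphi(\mathcal S^k_{n,L}u^k,u^k_{n-1},u^k_n)\\&\quad+j^0(\gamma_ju^k_n;\gamma_jv-\gamma_ju^k_n)+\langle j_c(\gamma_ju^k_n),\gamma_jv-\gamma_ju^k_n\rangle_{X_j}\\&\ge\langle f_n,v-u^k_n\rangle+\langle j_c(\gamma_ju^k_{n-1}),\gamma_jv-\gamma_ju^k_n\rangle_{X_j}.\end{aligned}$$ -/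

import Mathlib

open Filter Topology
open scoped NNReal

noncomputable section

/-- A real normed space is reflexive if the canonical embedding into its topological bidual
is onto. -/
def IsReflexiveSpace (X : Type*) [NormedAddCommGroup X] [NormedSpace ℝ X] : Prop :=
  Function.Surjective (NormedSpace.inclusionInDoubleDual ℝ X)

/-- The generalized (Clarke) directional derivative
`φ⁰(x; v) = limsup_{y → x, lam ↓ 0} (φ (y + lam v) - φ y) / lam`. For a locally Lipschitz `φ` the
difference quotients are locally bounded, so that this is a genuine real upper limit. -/
def clarkeDeriv {E : Type*} [NormedAddCommGroup E] [NormedSpace ℝ E]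
    (φ : E → ℝ) (x v : E) : ℝ :=
  limsup (fun p : E × ℝ => (φ (p.1 + p.2 • v) - φ p.1) / p.2) (𝓝 x ×ˢ 𝓝[>] (0 : ℝ))

/-- The Clarke generalized gradient `∂φ(x)`. -/
def clarkeSubdiff {E : Type*} [NormedAddCommGroup E] [NormedSpace ℝ E]
    (φ : E → ℝ) (x : E) : Set (StrongDual ℝ E) :=
  {ξ | ∀ v : E, ξ v ≤ clarkeDeriv φ x v}

/-- The node `t_n = n k` of the uniform grid with step `k = T / N`. -/
def gridNode (T : ℝ≥0) (N n : ℕ) : ℝ≥0 := n * (T / N)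

/-- The modified trapezoidal approximation of `(S v)(t) = R (∫ s in 0..t, q(t,s) v(s) + a_S)` at
`t = t_{n+1}` (`n = 0, …, N - 1`), with the left-point rule on the last sub-interval:
`R (k/2 q(t_{n+1}, t_0) v_0 + k ∑_{0 < j < n+1} q(t_{n+1}, t_j) v_j
  + k/2 q(t_{n+1}, t_n) v_n + a_S)`. -/
def discreteHistory {X Y : Type*} [NormedAddCommGroup X] [NormedSpace ℝ X]
    [NormedAddCommGroup Y] [NormedSpace ℝ Y]
    (R : X →L[ℝ] Y) (q : C(ℝ≥0 × ℝ≥0, X →L[ℝ] X)) (aS : X)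
    (T : ℝ≥0) (N : ℕ) (v : Fin (N + 1) → X) (n : Fin N) : Y :=
  R ((((T / N : ℝ≥0) : ℝ) / 2) • q (gridNode T N (n + 1), gridNode T N 0) (v 0)
    + ((T / N : ℝ≥0) : ℝ) •
        ∑ j ∈ Finset.Ioo 0 n.succ, q (gridNode T N (n + 1), gridNode T N j) (v j)
    + (((T / N : ℝ≥0) : ℝ) / 2) • q (gridNode T N (n + 1), gridNode T N n) (v n.castSucc)
    + aS)

/-- `u = (u_0, …, u_N) ⊂ K` solves the first-order semi-discrete scheme with starting value `u₀`:
the inequality holds at each of the steps `1, …, N` (step `n + 1` is indexed by `n : Fin N`, so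
that `u n.succ` is the current and `u n.castSucc` the previous value). -/
def SolvesFirstOrderScheme {X Xj Y : Type*} [NormedAddCommGroup X] [NormedSpace ℝ X]
    [NormedAddCommGroup Xj] [NormedSpace ℝ Xj] [NormedAddCommGroup Y] [NormedSpace ℝ Y]
    (K : Set X) (A : X → StrongDual ℝ X) (γ : X →L[ℝ] Xj) (φ : Y → X → X → ℝ)
    (j : Xj → ℝ) (jc : Xj →ₗ[ℝ] StrongDual ℝ Xj) (f : C(ℝ≥0, StrongDual ℝ X))
    (R : X →L[ℝ] Y) (q : C(ℝ≥0 × ℝ≥0, X →L[ℝ] X)) (aS : X)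
    (T : ℝ≥0) (N : ℕ) (u₀ : X) (u : Fin (N + 1) → X) : Prop :=
  (∀ n, u n ∈ K) ∧ u 0 = u₀ ∧
    ∀ n : Fin N, ∀ v ∈ K,
      f (gridNode T N (n + 1)) (v - u n.succ)
          + jc (γ (u n.castSucc)) (γ v - γ (u n.succ))
        ≤ A (u n.succ) (v - u n.succ)
          + φ (discreteHistory R q aS T N u n) (u n.castSucc) v
          - φ (discreteHistory R q aS T N u n) (u n.castSucc) (u n.succ)
          + clarkeDeriv j (γ (u n.succ)) (γ v - γ (u n.succ))
          + jc (γ (u n.succ)) (γ v - γ (u n.succ))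

end

/-! At each step the history term and the second argument of `φ` involve earlier values only, so `φ`
acts as a fixed convex function and its constants never compete with `m_A`. The coercivity of the
implicit `jc` term absorbs exactly the defect `α_j` in the monotonicity of the Clarke derivative.
What remains is an equilibrium problem `0 ≤ F u v` with `F` strongly monotone of constant `m_A`,
which gives uniqueness at once.

Existence is by Minty's method (`existsUnique_equilibrium`). The sets of `u ∈ K` with `F v u + m/2 *
dist u v ^ 2 ≤ 0` are closed and convex, and all are bounded because the quadratic term beats the
linear lower bound on `F v`. A minimax argument for finite games gives the finite intersection
property, and reflexivity then gives a common point. Convexity along segments and hemicontinuity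
turn this point into a solution. Induction over the steps finishes the proof. -/

/-! ### Finite games -/

/-- A finite symmetric game has an optimal strategy: if `a i k + a k i ≤ 0` for all `i`, `k`, some
point of the simplex makes all the averages `∑ k, μ k * a i k` nonpositive. -/
theorem exists_mem_stdSimplex_forall_sum_mul_nonpos {ι : Type*} [Fintype ι] [Nonempty ι]
    (a : ι → ι → ℝ) (ha : ∀ i k, a i k + a k i ≤ 0) :
    ∃ μ ∈ stdSimplex ℝ ι, ∀ i, ∑ k, μ k * a i k ≤ 0 := by
  classical
  by_contra! hcon
  let B : (ι → ℝ) →ₗ[ℝ] (ι → ℝ) := LinearMap.pi fun i => ∑ k, a i k • LinearMap.proj k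
  have hB : ∀ μ i, B μ i = ∑ k, μ k * a i k := fun μ i => by
    simp [B, mul_comm]
  have hBc : Continuous B := B.continuous_of_finiteDimensional
  have hcl : IsClosed {x : ι → ℝ | ∀ i, x i ≤ 0} := by
    simp only [Set.ofPred_forall]
    exact isClosed_iInter fun i => isClosed_le (continuous_apply i) continuous_const
  have hcv : Convex ℝ {x : ι → ℝ | ∀ i, x i ≤ 0} := by
    intro x hx y hy s t hs ht _ i
    have h1 := mul_nonpos_of_nonneg_of_nonpos hs (hx i)
    have h2 := mul_nonpos_of_nonneg_of_nonpos ht (hy i)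
    simpa using add_nonpos h1 h2
  obtain ⟨g, u, v, hu, huv, hv⟩ := geometric_hahn_banach_closed_compact hcv hcl
    ((convex_stdSimplex ℝ ι).linear_image B) ((isCompact_stdSimplex ℝ ι).image hBc) (by
      rw [Set.disjoint_left]
      rintro x hx ⟨μ, hμ, rfl⟩
      obtain ⟨i, hi⟩ := hcon μ hμ
      have := hx i
      rw [hB] at this
      linarith)
  have hu0 : 0 < u := by simpa using hu 0 (by simp)
  have hg : ∀ x, g x = ∑ i, x i * g (Pi.single i 1) := fun x => by
    conv_lhs => rw [pi_eq_sum_univ' x]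
    simp [map_sum, Pi.single]
  set l : ι → ℝ := fun i => g (Pi.single i 1) with hl
  have hl0 : ∀ i, 0 ≤ l i := by
    intro i
    by_contra! hi
    -- If `l i < 0`, this point of the nonpositive orthant is scaled so that `g` equals `u` on it,
    -- against the strict bound.
    have h := hu (-(u / -(l i)) • Pi.single i 1) (by
      intro k
      have : 0 ≤ u / -(l i) := by apply div_nonneg <;> linarith
      by_cases hk : k = i
      · subst hk; simpa using this
      · simp [hk])
    rw [map_smul, smul_eq_mul] at h
    change -(u / -(l i)) * l i < u at h
    have : -(u / -(l i)) * l i = u := by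
      have := hi.ne
      field_simp
    linarith
  have hpos : 0 < ∑ i, l i := by
    refine lt_of_le_of_ne (Finset.sum_nonneg fun i _ => hl0 i) fun h => ?_
    have hz := (Finset.sum_eq_zero_iff_of_nonneg (fun i _ => hl0 i)).1 h.symm
    obtain ⟨i⟩ := ‹Nonempty ι›
    have h2 := hv _ ⟨_, single_mem_stdSimplex ℝ i, rfl⟩
    rw [hg, Finset.sum_eq_zero fun k hk => by
      change _ * l k = 0
      rw [hz k hk, mul_zero]] at h2
    linarith
  -- Symmetrise in `i` and `k`. The normalised `l` is then a point of the simplex on which `g ∘ B`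
  -- is nonpositive, contradicting `0 < u < v`.
  have hquad : ∑ i, ∑ k, l i * l k * a i k ≤ 0 := by
    have h1 : ∑ i, ∑ k, l i * l k * a i k = ∑ i, ∑ k, l i * l k * a k i := by
      rw [Finset.sum_comm]
      exact Finset.sum_congr rfl fun i _ => Finset.sum_congr rfl fun k _ => by ring
    have h2 : ∑ i, ∑ k, l i * l k * a i k + ∑ i, ∑ k, l i * l k * a k i ≤ 0 := by
      simp only [← Finset.sum_add_distrib]
      refine Finset.sum_nonpos fun i _ => Finset.sum_nonpos fun k _ => ?_
      rw [← mul_add]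
      exact mul_nonpos_of_nonneg_of_nonpos (mul_nonneg (hl0 i) (hl0 k)) (ha i k)
    linarith
  have h := hv (B fun k => l k / ∑ i, l i) ⟨_, ⟨fun i => div_nonneg (hl0 i) hpos.le, by
    rw [← Finset.sum_div, div_self hpos.ne']⟩, rfl⟩
  have h3 : g (B fun k => l k / ∑ i, l i) = (∑ i, ∑ k, l i * l k * a i k) / ∑ i, l i := by
    rw [hg, Finset.sum_div]
    refine Finset.sum_congr rfl fun i _ => ?_
    rw [hB, Finset.sum_mul, Finset.sum_div]
    refine Finset.sum_congr rfl fun k _ => ?_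
    change _ * l i = _
    ring
  have := div_nonpos_of_nonpos_of_nonneg hquad hpos.le
  linarith

/-! ### Weak compactness in reflexive spaces -/

/-- By reflexivity a point off the image comes from some `x ∉ s`. A functional separating `x` from
`s` is an evaluation in the weak-* topology, so it cuts out an open neighbourhood missing the image.
-/
theorem IsReflexiveSpace.isClosed_image_toWeakDual {X : Type*} [NormedAddCommGroup X]
    [NormedSpace ℝ X] (hX : IsReflexiveSpace X) {s : Set X} (hs : IsClosed s)
    (hc : Convex ℝ s) :
    IsClosed ((fun x => StrongDual.toWeakDual (NormedSpace.inclusionInDoubleDual ℝ X x)) '' s) := by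
  rw [← isOpen_compl_iff, isOpen_iff_mem_nhds]
  intro Φ hΦ
  obtain ⟨x, hx⟩ := hX (WeakDual.toStrongDual Φ)
  have hxs : x ∉ s := fun h => hΦ ⟨x, h, congrArg StrongDual.toWeakDual hx⟩
  obtain ⟨g, u, hu, hgx⟩ := geometric_hahn_banach_closed_point hc hs hxs
  have hval : Φ g = g x := by
    rw [← NormedSpace.dual_def ℝ X x g, hx]; rfl
  have hopen : IsOpen {Ψ : WeakDual ℝ (StrongDual ℝ X) | u < Ψ g} :=
    isOpen_lt continuous_const (WeakDual.eval_continuous g)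
  refine mem_of_superset (hopen.mem_nhds (by simpa [hval] using hgx)) ?_
  rintro Ψ hΨ ⟨y, hy, rfl⟩
  exact lt_asymm (hu y hy) hΨ

/-- In a reflexive space, closed convex sets with the finite intersection property, one of which is
bounded, have a common point. -/
theorem IsReflexiveSpace.nonempty_iInter {X : Type*} [NormedAddCommGroup X]
    [NormedSpace ℝ X] (hX : IsReflexiveSpace X) {ι : Type*} (M : ι → Set X)
    (hcl : ∀ i, IsClosed (M i)) (hcv : ∀ i, Convex ℝ (M i)) (i₀ : ι)
    (hb : Bornology.IsBounded (M i₀))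
    (hfin : ∀ s : Finset ι, s.Nonempty → (⋂ i ∈ s, M i).Nonempty) : (⋂ i, M i).Nonempty := by
  classical
  obtain ⟨r, hr⟩ := hb.subset_closedBall 0
  set e : X → WeakDual ℝ (StrongDual ℝ X) :=
    fun x => StrongDual.toWeakDual (NormedSpace.inclusionInDoubleDual ℝ X x) with he
  have hinj : Function.Injective e :=
    StrongDual.toWeakDual.injective.comp (NormedSpace.inclusionInDoubleDualLi ℝ).injective
  have hcpt := WeakDual.isCompact_closedBall (𝕜 := ℝ) (0 : StrongDual ℝ (StrongDual ℝ X)) r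
  obtain ⟨Φ, -, hΦ⟩ := hcpt.inter_iInter_nonempty (fun i => e '' M i)
    (fun i => hX.isClosed_image_toWeakDual (hcl i) (hcv i)) (by
      intro s
      obtain ⟨x, hx⟩ := hfin (insert i₀ s) (Finset.insert_nonempty _ _)
      simp only [Set.mem_iInter] at hx
      refine ⟨e x, ?_, ?_⟩
      · have h0 := hr (hx i₀ (Finset.mem_insert_self _ _))
        have h1 := NormedSpace.double_dual_bound ℝ X x
        rw [mem_closedBall_zero_iff] at h0
        simp only [Set.mem_preimage, mem_closedBall_zero_iff]
        exact h1.trans h0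
      · simp only [Set.mem_iInter]
        exact fun i hi => ⟨x, hx i (Finset.mem_insert_of_mem hi), rfl⟩)
  simp only [Set.mem_iInter] at hΦ
  obtain ⟨x, hx, rfl⟩ := hΦ i₀
  refine ⟨x, Set.mem_iInter.2 fun i => ?_⟩
  obtain ⟨y, hy, hyx⟩ := hΦ i
  exact hinj hyx ▸ hy

/-! ### Strongly monotone equilibrium problems -/

/-- A convex lower semicontinuous function on a convex set is bounded below by a function of linear
growth. -/
theorem exists_forall_neg_one_sub_mul_norm_le {X : Type*} [NormedAddCommGroup X] [NormedSpace ℝ X]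
    {K : Set X} {g : X → ℝ} (hconv : ConvexOn ℝ K g) (hlsc : LowerSemicontinuousOn g K)
    {x : X} (hx : x ∈ K) :
    ∃ C : ℝ, 0 ≤ C ∧ ∀ u ∈ K, g x - 1 - C * ‖u - x‖ ≤ g u := by
  have h := hlsc x hx (g x - 1) (by linarith)
  obtain ⟨δ, hδ, hball⟩ := Metric.mem_nhdsWithin_iff.1 h
  refine ⟨2 / δ, by positivity, fun u hu => ?_⟩
  by_cases hd : ‖u - x‖ < δ
  · have h1 : g x - 1 < g u := hball ⟨by rwa [Metric.mem_ball, dist_eq_norm], hu⟩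
    have : 0 ≤ 2 / δ * ‖u - x‖ := by positivity
    linarith
  push Not at hd
  have hr : 0 < ‖u - x‖ := hδ.trans_le hd
  -- Places the convex combination at distance `δ / 2` from `x`, inside the ball where `g` exceeds
  -- `g x - 1`.
  set s : ℝ := δ / (2 * ‖u - x‖) with hs
  have hs0 : 0 < s := by positivity
  have hs1 : s ≤ 1 := by
    rw [hs, div_le_one (by positivity)]
    linarith
  have hwK : (1 - s) • x + s • u ∈ K := hconv.1 hx hu (by linarith) hs0.le (by ring)
  have hw : g x - 1 < g ((1 - s) • x + s • u) := by
    refine hball ⟨?_, hwK⟩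
    rw [Metric.mem_ball, dist_eq_norm,
      show (1 - s) • x + s • u - x = s • (u - x) by module, norm_smul, Real.norm_eq_abs,
      abs_of_pos hs0, hs]
    have : δ / (2 * ‖u - x‖) * ‖u - x‖ = δ / 2 := by field_simp
    linarith
  have hc := hconv.2 hx hu (by linarith : 0 ≤ 1 - s) hs0.le (by ring)
  simp only [smul_eq_mul] at hc
  have h2 : 0 < s * (g u - g x + 2 / δ * ‖u - x‖) := by
    have : s * (2 / δ * ‖u - x‖) = 1 := by rw [hs]; field_simp
    nlinarith
  have := pos_of_mul_pos_right h2 hs0.le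
  linarith

/-- Unique solvability of an equilibrium problem governed by a strongly monotone bifunction on a
closed convex subset of a reflexive space. -/
theorem IsReflexiveSpace.existsUnique_equilibrium {X : Type*} [NormedAddCommGroup X]
    [NormedSpace ℝ X] (hX : IsReflexiveSpace X) {K : Set X} (hKcl : IsClosed K)
    (hKne : K.Nonempty) {F : X → X → ℝ} {m : ℝ} (hm : 0 < m)
    (hdiag : ∀ v ∈ K, F v v = 0)
    (hmono : ∀ u ∈ K, ∀ v ∈ K, F u v + F v u ≤ -(m * ‖u - v‖ ^ 2))
    (hconv : ∀ v ∈ K, ConvexOn ℝ K (F v))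
    (hlsc : ∀ v ∈ K, LowerSemicontinuousOn (F v) K)
    (hhemi : ∀ u ∈ K, ∀ v ∈ K,
      (∀ t ∈ Set.Ioo (0 : ℝ) 1, 0 ≤ F (u + t • (v - u)) v) → 0 ≤ F u v) :
    ∃! u, u ∈ K ∧ ∀ v ∈ K, 0 ≤ F u v := by
  obtain ⟨x, hx⟩ := hKne
  have hKcv : Convex ℝ K := (hconv x hx).1
  set G : X → X → ℝ := fun v u => F v u + m / 2 * dist u v ^ 2 with hG
  have hGconv : ∀ v ∈ K, ConvexOn ℝ K (G v) := fun v hv =>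
    (hconv v hv).add (((convexOn_dist v hKcv).pow (fun _ _ => dist_nonneg) 2).smul
      (by positivity : 0 ≤ m / 2))
  have hGlsc : ∀ v ∈ K, LowerSemicontinuousOn (G v) K := fun v hv =>
    have hc : Continuous fun u => m / 2 * dist u v ^ 2 := by fun_prop
    (hlsc v hv).add (hc.lowerSemicontinuous.lowerSemicontinuousOn K)
  let M : K → Set X := fun v => {u ∈ K | G v u ≤ 0}
  have hMcl : ∀ v, IsClosed (M v) := fun v => by
    obtain ⟨t, ht, htK⟩ := lowerSemicontinuousOn_iff_preimage_Iic.1 (hGlsc v v.2) 0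
    have : M v = K ∩ t := by rw [← htK]; rfl
    rw [this]
    exact hKcl.inter ht
  have hMcv : ∀ v, Convex ℝ (M v) := fun v => (hGconv v v.2).convex_le 0
  have hMb : Bornology.IsBounded (M ⟨x, hx⟩) := by
    obtain ⟨C, hC, hb⟩ := exists_forall_neg_one_sub_mul_norm_le (hconv x hx) (hlsc x hx) hx
    refine (Metric.isBounded_iff_subset_closedBall x).2 ⟨(2 * C + 1) / m + 1, fun u hu => ?_⟩
    have h1 := hb u hu.1
    have h2 : F x u + m / 2 * dist u x ^ 2 ≤ 0 := hu.2
    rw [hdiag x hx] at h1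
    rw [Metric.mem_closedBall]
    rw [← dist_eq_norm] at h1
    by_contra! h3
    have h4 : 2 * C + 1 + m < m * dist u x := by
      have := mul_lt_mul_of_pos_left h3 hm
      rw [mul_add, mul_div_cancel₀ _ hm.ne'] at this
      linarith
    have h5 : 1 < dist u x := by
      have : 0 ≤ (2 * C + 1) / m := by positivity
      linarith
    nlinarith
  obtain ⟨u, hu⟩ := hX.nonempty_iInter M hMcl hMcv ⟨x, hx⟩ hMb (by
    intro s hs
    have : Nonempty s := hs.to_subtype
    obtain ⟨μ, hμ, h⟩ := exists_mem_stdSimplex_forall_sum_mul_nonpos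
      (fun i k : s => G i k) (by
        rintro ⟨i, _⟩ ⟨k, _⟩
        have := hmono i i.2 k k.2
        simp only [hG, dist_comm (k : X) (i : X), dist_eq_norm (i : X) (k : X)]
        linarith)
    -- The optimal mixed strategy serves as barycentric weights; Jensen's inequality for each `G i`
    -- puts the barycentre in every `M i`.
    refine ⟨∑ k : s, μ k • (k : X), ?_⟩
    simp only [Set.mem_iInter]
    intro i hi
    refine ⟨hKcv.sum_mem (fun k _ => hμ.1 k) hμ.2 (fun k _ => (k : K).2), ?_⟩
    exact ((hGconv i i.2).map_sum_le (fun k _ => hμ.1 k) hμ.2 (fun k _ => (k : K).2)).trans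
      (h ⟨i, hi⟩))
  rw [Set.mem_iInter] at hu
  have huK : u ∈ K := (hu ⟨x, hx⟩).1
  have hsol : ∀ v ∈ K, 0 ≤ F u v := by
    refine fun v hv => hhemi u huK v hv fun t ht => ?_
    have hseg : u + t • (v - u) = (1 - t) • u + t • v := by module
    have h1t : 0 ≤ 1 - t := by linarith [ht.2]
    have hw : u + t • (v - u) ∈ K := hseg ▸ hKcv huK hv h1t ht.1.le (by ring)
    set w := u + t • (v - u)
    -- Minty's trick: `0 = F w w ≤ (1 - t) * F w u + t * F w v` with `F w u ≤ 0` forces `0 ≤ F w v`.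
    have h1 := (hconv w hw).2 huK hv h1t ht.1.le (by ring)
    rw [← hseg, hdiag w hw, smul_eq_mul, smul_eq_mul] at h1
    have h2 : F w u + m / 2 * dist u w ^ 2 ≤ 0 := (hu ⟨w, hw⟩).2
    have h3 : F w u ≤ 0 := by
      have : 0 ≤ m / 2 * dist u w ^ 2 := by positivity
      linarith
    have h4 := mul_nonpos_of_nonneg_of_nonpos h1t h3
    exact nonneg_of_mul_nonneg_right (by linarith) ht.1
  refine ⟨u, ⟨huK, hsol⟩, ?_⟩
  rintro w ⟨hwK, hw⟩
  have h1 := hmono w hwK u huK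
  have h2 := hw u huK
  have h3 := hsol w hwK
  have h4 : m * ‖w - u‖ ^ 2 ≤ 0 := by linarith
  have h5 : ‖w - u‖ ^ 2 ≤ 0 := by
    by_contra! h
    have := mul_pos hm h
    linarith
  have h6 : ‖w - u‖ = 0 := by
    exact pow_eq_zero_iff two_ne_zero |>.1 (le_antisymm h5 (by positivity))
  exact sub_eq_zero.1 (norm_eq_zero.1 h6)

/-! ### Calculus of the Clarke derivative -/

section Clarke

variable {E : Type*} [NormedAddCommGroup E] [NormedSpace ℝ E] {φ : E → ℝ}

theorem tendsto_fst_add_snd_smul (x w : E) :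
    Tendsto (fun p : E × ℝ => p.1 + p.2 • w) (𝓝 x ×ˢ 𝓝[>] (0 : ℝ)) (𝓝 x) := by
  have h : Tendsto (fun p : E × ℝ => p.1 + p.2 • w) (𝓝 (x, (0 : ℝ))) (𝓝 x) := by
    have : Continuous fun p : E × ℝ => p.1 + p.2 • w := by fun_prop
    simpa using this.tendsto (x, (0 : ℝ))
  rw [nhds_prod_eq] at h
  exact h.mono_left (Filter.prod_mono le_rfl nhdsWithin_le_nhds)

theorem eventually_snd_pos {E : Type*} [TopologicalSpace E] (x : E) : ∀ᶠ p : E × ℝ in 𝓝 x ×ˢ 𝓝[>] (0 : ℝ), 0 < p.2 :=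
  tendsto_snd.eventually self_mem_nhdsWithin

theorem LocallyLipschitz.exists_eventually_abs_quotient_le (h : LocallyLipschitz φ) (x : E) :
    ∃ L : ℝ, 0 ≤ L ∧ ∀ v, ∀ᶠ p : E × ℝ in 𝓝 x ×ˢ 𝓝[>] (0 : ℝ),
      |(φ (p.1 + p.2 • v) - φ p.1) / p.2| ≤ L * ‖v‖ := by
  obtain ⟨L, t, ht, hL⟩ := h x
  refine ⟨L, L.2, fun v => ?_⟩
  filter_upwards [tendsto_fst.eventually ht, (tendsto_fst_add_snd_smul x v).eventually ht,
    eventually_snd_pos x] with p h1 h2 h3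
  have := hL.dist_le_mul _ h2 _ h1
  rw [dist_eq_norm, dist_eq_norm, add_sub_cancel_left, norm_smul, Real.norm_eq_abs,
    Real.norm_eq_abs, abs_of_pos h3] at this
  rw [abs_div, abs_of_pos h3, div_le_iff₀ h3]
  linarith

theorem LocallyLipschitz.clarkeDeriv_le (h : LocallyLipschitz φ) {x v : E} {c : ℝ}
    (hc : ∀ᶠ p : E × ℝ in 𝓝 x ×ˢ 𝓝[>] (0 : ℝ), (φ (p.1 + p.2 • v) - φ p.1) / p.2 ≤ c) :
    clarkeDeriv φ x v ≤ c := by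
  obtain ⟨L, -, hL⟩ := h.exists_eventually_abs_quotient_le x
  refine limsup_le_of_le ?_ hc
  exact IsBoundedUnder.isCoboundedUnder_le
    ⟨-(L * ‖v‖), (hL v).mono fun p hp => (abs_le.1 hp).1⟩

theorem LocallyLipschitz.eventually_lt_of_clarkeDeriv_lt (h : LocallyLipschitz φ) {x v : E}
    {c : ℝ} (hc : clarkeDeriv φ x v < c) :
    ∀ᶠ p : E × ℝ in 𝓝 x ×ˢ 𝓝[>] (0 : ℝ), (φ (p.1 + p.2 • v) - φ p.1) / p.2 < c := by
  obtain ⟨L, -, hL⟩ := h.exists_eventually_abs_quotient_le x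
  exact eventually_lt_of_limsup_lt hc ⟨L * ‖v‖, (hL v).mono fun p hp => (abs_le.1 hp).2⟩

theorem clarkeDeriv_zero_right (x : E) : clarkeDeriv φ x 0 = 0 := by
  simp [clarkeDeriv]

theorem LocallyLipschitz.exists_clarkeDeriv_le_norm (h : LocallyLipschitz φ) (x : E) :
    ∃ L : ℝ, 0 ≤ L ∧ ∀ v, clarkeDeriv φ x v ≤ L * ‖v‖ := by
  obtain ⟨L, hL0, hL⟩ := h.exists_eventually_abs_quotient_le x
  exact ⟨L, hL0, fun v => h.clarkeDeriv_le ((hL v).mono fun p hp => (abs_le.1 hp).2)⟩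

theorem LocallyLipschitz.clarkeDeriv_add_le (h : LocallyLipschitz φ) (x v w : E) :
    clarkeDeriv φ x (v + w) ≤ clarkeDeriv φ x v + clarkeDeriv φ x w := by
  refine le_of_forall_pos_le_add fun ε hε => h.clarkeDeriv_le ?_
  have hv := h.eventually_lt_of_clarkeDeriv_lt
    (show clarkeDeriv φ x v < clarkeDeriv φ x v + ε / 2 by linarith)
  have hw := h.eventually_lt_of_clarkeDeriv_lt
    (show clarkeDeriv φ x w < clarkeDeriv φ x w + ε / 2 by linarith)
  -- The base point varies in the upper limit, so the quotient along `v` may start from `p.1 + p.2 •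
  -- w`.
  have ht : Tendsto (fun p : E × ℝ => (p.1 + p.2 • w, p.2)) (𝓝 x ×ˢ 𝓝[>] (0 : ℝ))
      (𝓝 x ×ˢ 𝓝[>] (0 : ℝ)) := (tendsto_fst_add_snd_smul x w).prodMk tendsto_snd
  filter_upwards [ht.eventually hv, hw] with p h1 h2
  have : p.1 + p.2 • (v + w) = p.1 + p.2 • w + p.2 • v := by rw [smul_add]; abel
  rw [this]
  rw [show φ (p.1 + p.2 • w + p.2 • v) - φ p.1 = (φ (p.1 + p.2 • w + p.2 • v)
    - φ (p.1 + p.2 • w)) + (φ (p.1 + p.2 • w) - φ p.1) by ring, add_div]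
  linarith

theorem LocallyLipschitz.clarkeDeriv_smul_le (h : LocallyLipschitz φ) (x v : E) {s : ℝ}
    (hs : 0 < s) : clarkeDeriv φ x (s • v) ≤ s * clarkeDeriv φ x v := by
  refine le_of_forall_pos_le_add fun ε hε => h.clarkeDeriv_le ?_
  have hv := h.eventually_lt_of_clarkeDeriv_lt
    (show clarkeDeriv φ x v < clarkeDeriv φ x v + ε / s by have := div_pos hε hs; linarith)
  have hm : Tendsto (fun r : ℝ => r * s) (𝓝[>] (0 : ℝ)) (𝓝[>] (0 : ℝ)) := by
    refine tendsto_nhdsWithin_iff.2 ⟨?_, ?_⟩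
    · have : Tendsto (fun r : ℝ => r * s) (𝓝 0) (𝓝 0) := by
        simpa using (continuous_mul_const s).tendsto 0
      exact this.mono_left nhdsWithin_le_nhds
    · filter_upwards [self_mem_nhdsWithin] with r hr using mul_pos hr hs
  have ht : Tendsto (fun p : E × ℝ => (p.1, p.2 * s)) (𝓝 x ×ˢ 𝓝[>] (0 : ℝ))
      (𝓝 x ×ˢ 𝓝[>] (0 : ℝ)) := tendsto_fst.prodMk (hm.comp tendsto_snd)
  filter_upwards [ht.eventually hv, eventually_snd_pos x] with p h1 h2
  simp only [mul_smul] at h1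
  rw [div_lt_iff₀ (mul_pos h2 hs)] at h1
  rw [div_le_iff₀ h2]
  have : (clarkeDeriv φ x v + ε / s) * (p.2 * s) = (s * clarkeDeriv φ x v + ε) * p.2 := by
    field_simp
  linarith

theorem LocallyLipschitz.clarkeDeriv_smul (h : LocallyLipschitz φ) (x v : E) {s : ℝ}
    (hs : 0 ≤ s) : clarkeDeriv φ x (s • v) = s * clarkeDeriv φ x v := by
  obtain rfl | hs := hs.eq_or_lt
  · simp [clarkeDeriv_zero_right]
  refine le_antisymm (h.clarkeDeriv_smul_le x v hs) ?_
  have := h.clarkeDeriv_smul_le x (s • v) (inv_pos.2 hs)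
  rw [inv_smul_smul₀ hs.ne', inv_mul_eq_div, le_div_iff₀ hs] at this
  linarith

theorem LocallyLipschitz.convexOn_clarkeDeriv (h : LocallyLipschitz φ) (x : E) :
    ConvexOn ℝ Set.univ (clarkeDeriv φ x) := by
  refine ⟨convex_univ, fun v _ w _ a b ha hb _ => ?_⟩
  rw [smul_eq_mul, smul_eq_mul, ← h.clarkeDeriv_smul x v ha, ← h.clarkeDeriv_smul x w hb]
  exact h.clarkeDeriv_add_le x _ _

theorem LocallyLipschitz.continuous_clarkeDeriv (h : LocallyLipschitz φ) (x : E) :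
    Continuous (clarkeDeriv φ x) := by
  obtain ⟨L, hL0, hL⟩ := h.exists_clarkeDeriv_le_norm x
  refine (LipschitzWith.of_le_add_mul ⟨L, hL0⟩ fun v w => ?_).continuous
  have h1 := h.clarkeDeriv_add_le x w (v - w)
  rw [add_sub_cancel] at h1
  rw [dist_eq_norm]
  exact h1.trans (add_le_add_right (hL _) _)

theorem LocallyLipschitz.upperSemicontinuous_clarkeDeriv (h : LocallyLipschitz φ) (v : E) :
    UpperSemicontinuous fun x => clarkeDeriv φ x v := by
  intro x c hc
  -- A bound on the quotients for base points near `x` also holds near every `y` close to `x`; `d`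
  -- leaves room for the non-strict limit.
  obtain ⟨d, hd, hdc⟩ := exists_between hc
  obtain ⟨pa, ha, pb, hb, hab⟩ := eventually_prod_iff.1 (h.eventually_lt_of_clarkeDeriv_lt hd)
  filter_upwards [ha.eventually_nhds] with y hy
  refine lt_of_le_of_lt (h.clarkeDeriv_le ?_) hdc
  exact (eventually_prod_iff.2 ⟨pa, hy, pb, hb, fun hx _ hy => (hab hx hy).le⟩)

end Clarke

/-! ### The stationary inequality -/

/-- Unique solvability of a variational-hemivariational inequality in which the relaxed
monotonicity of `j` is compensated by the coercive operator `jc`. -/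
theorem IsReflexiveSpace.existsUnique_variationalHemivariational
    {X Xj : Type*} [NormedAddCommGroup X] [NormedSpace ℝ X]
    [NormedAddCommGroup Xj] [NormedSpace ℝ Xj] (hX : IsReflexiveSpace X)
    {K : Set X} (hKcl : IsClosed K) (hKne : K.Nonempty) (γ : X →L[ℝ] Xj)
    {A : X → StrongDual ℝ X} (hA : Continuous A) {m : ℝ} (hm : 0 < m)
    (hA_mono : ∀ v₁ v₂, m * ‖v₁ - v₂‖ ^ 2 ≤ (A v₁ - A v₂) (v₁ - v₂))
    {ψ : X → ℝ} (hψ_convex : ConvexOn ℝ K ψ) (hψ_lsc : LowerSemicontinuousOn ψ K)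
    {j : Xj → ℝ} (hj : LocallyLipschitz j) {α : ℝ}
    (hj_relaxed : ∀ z₁ z₂,
      clarkeDeriv j z₁ (z₂ - z₁) + clarkeDeriv j z₂ (z₁ - z₂) ≤ α * ‖z₁ - z₂‖ ^ 2)
    (jc : Xj →L[ℝ] StrongDual ℝ Xj) (hjc : ∀ z, α * ‖z‖ ^ 2 ≤ jc z z) (g : StrongDual ℝ X) :
    ∃! u, u ∈ K ∧ ∀ v ∈ K, g (v - u) ≤ A u (v - u) + ψ v - ψ u
      + clarkeDeriv j (γ u) (γ v - γ u) + jc (γ u) (γ v - γ u) := by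
  set F : X → X → ℝ := fun u v => (A u (v - u) + jc (γ u) (γ v - γ u) - g (v - u))
    + (ψ v - ψ u) + clarkeDeriv j (γ u) (γ v - γ u) with hF
  have key := hX.existsUnique_equilibrium hKcl hKne (F := F) hm (fun v _ => by
    simp [hF, clarkeDeriv_zero_right]) ?_ ?_ ?_ ?_
  · refine (existsUnique_congr fun u => and_congr_right fun _ => forall₂_congr fun v _ => ?_).1 key
    simp only [hF]
    constructor <;> intro h <;> linarith
  · intro u _ v _
    have h1 := hA_mono u v
    -- The two terms `α * ‖γ u - γ v‖ ^ 2` from `h2` and `h3` cancel, leaving the full `m` from `A`.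
    have h2 := hj_relaxed (γ u) (γ v)
    have h3 := hjc (γ u - γ v)
    simp only [hF, map_sub, sub_apply] at h1 h3 ⊢
    linarith
  · intro u _
    have h1 : ConvexOn ℝ K fun v => A u (v - u) + jc (γ u) (γ v - γ u) - g (v - u) := by
      refine ⟨hψ_convex.1, fun v _ w _ a b _ _ hab => le_of_eq ?_⟩
      simp only [map_sub, map_add, map_smul, smul_eq_mul]
      linear_combination (A u u + jc (γ u) (γ u) - g u) * hab
    have h2 : ConvexOn ℝ K fun v => ψ v - ψ u := by
      simp only [sub_eq_add_neg]
      exact hψ_convex.add_const (-ψ u)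
    have h3 : ConvexOn ℝ K fun v => clarkeDeriv j (γ u) (γ v - γ u) := by
      refine ⟨hψ_convex.1, fun v _ w _ a b ha hb hab => ?_⟩
      have := (hj.convexOn_clarkeDeriv (γ u)).2 (Set.mem_univ (γ v - γ u))
        (Set.mem_univ (γ w - γ u)) ha hb hab
      have he : a • (γ v - γ u) + b • (γ w - γ u) = γ (a • v + b • w) - γ u := by
        obtain rfl : b = 1 - a := by linarith
        simp only [map_add, map_smul]
        module
      rwa [he] at this
    exact (h1.add h2).add h3
  · intro u _
    have h1 : Continuous fun v => A u (v - u) + jc (γ u) (γ v - γ u) - g (v - u) := by fun_prop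
    have h2 : Continuous fun v => clarkeDeriv j (γ u) (γ v - γ u) :=
      (hj.continuous_clarkeDeriv (γ u)).comp (by fun_prop)
    have h3 : LowerSemicontinuousOn (fun v => ψ v - ψ u) K := by
      simpa [sub_eq_add_neg] using hψ_lsc.add
        ((continuous_const (y := -ψ u)).lowerSemicontinuous.lowerSemicontinuousOn K)
    exact ((h1.lowerSemicontinuous.lowerSemicontinuousOn K).add h3).add
      (h2.lowerSemicontinuous.lowerSemicontinuousOn K)
  · intro u hu v hv h
    refine le_of_forall_pos_le_add fun ε hε => ?_
    have hp : Continuous fun t : ℝ => u + t • (v - u) := by fun_prop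
    have hp0 : Tendsto (fun t : ℝ => u + t • (v - u)) (𝓝[>] 0) (𝓝 u) := by
      have := hp.tendsto 0
      simp only [zero_smul, add_zero] at this
      exact this.mono_left nhdsWithin_le_nhds
    have hIoo : ∀ᶠ t : ℝ in 𝓝[>] 0, t ∈ Set.Ioo (0 : ℝ) 1 := Ioo_mem_nhdsGT one_pos
    have hpK : ∀ᶠ t : ℝ in 𝓝[>] 0, u + t • (v - u) ∈ K := by
      filter_upwards [hIoo] with t ht
      have := hψ_convex.1 hu hv (by linarith [ht.2] : 0 ≤ 1 - t) ht.1.le (by ring)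
      rwa [show (1 - t) • u + t • v = u + t • (v - u) by module] at this
    have e1 : ∀ᶠ t : ℝ in 𝓝[>] 0, ψ u - ε / 4 < ψ (u + t • (v - u)) :=
      (tendsto_nhdsWithin_iff.2 ⟨hp0, hpK⟩).eventually (hψ_lsc u hu _ (by linarith))
    have hc : Continuous fun w => A w (v - w) + jc (γ w) (γ v - γ w) - g (v - w) := by fun_prop
    have e2 := hp0.eventually (hc.continuousAt.eventually_lt_const
      (show A u (v - u) + jc (γ u) (γ v - γ u) - g (v - u)
        < A u (v - u) + jc (γ u) (γ v - γ u) - g (v - u) + ε / 4 by linarith))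
    set b := clarkeDeriv j (γ u) (γ v - γ u) with hb
    have e3 := ((γ.continuous.tendsto u).comp hp0).eventually
      (hj.upperSemicontinuous_clarkeDeriv (γ v - γ u) (γ u) (b + ε / 4) (by linarith))
    have e4 : ∀ᶠ t : ℝ in 𝓝[>] 0, (1 - t) * (b + ε / 4) < b + ε / 2 := by
      have hc : Continuous fun t : ℝ => (1 - t) * (b + ε / 4) := by fun_prop
      exact (hc.continuousAt.eventually_lt_const (by linarith)).filter_mono nhdsWithin_le_nhds
    obtain ⟨t, ht, e1, e2, e3, e4⟩ := (hIoo.and (e1.and (e2.and (e3.and e4)))).exists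
    have h0 := h t ht
    -- Homogeneity reduces to a fixed direction, so semicontinuity in the base point alone suffices.
    have hdir : γ v - γ (u + t • (v - u)) = (1 - t) • (γ v - γ u) := by
      simp only [map_add, map_smul, map_sub]
      module
    have e5 : clarkeDeriv j (γ (u + t • (v - u))) (γ v - γ (u + t • (v - u)))
        ≤ (1 - t) * (b + ε / 4) := by
      rw [hdir, hj.clarkeDeriv_smul _ _ (by linarith [ht.2] : 0 ≤ 1 - t)]
      exact mul_le_mul_of_nonneg_left (le_of_lt e3) (by linarith [ht.2])
    simp only [hF] at h0 ⊢
    linarith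

/-! ### Time stepping -/

/-- A one-step scheme of `N` steps, each of them uniquely solvable in `K` and depending on the
previous values only, has a unique solution with a given starting value. -/
theorem existsUnique_fin_of_step {X : Type*} {K : Set X} {N : ℕ}
    {P : Fin N → (Fin (N + 1) → X) → X → Prop}
    (hcongr : ∀ n u w x, (∀ i ≤ n.castSucc, u i = w i) → P n u x → P n w x)
    (hstep : ∀ n u, (∀ i, u i ∈ K) → ∃! x, x ∈ K ∧ P n u x) {u₀ : X} (hu₀ : u₀ ∈ K) :
    ∃! u : Fin (N + 1) → X, (∀ n, u n ∈ K) ∧ u 0 = u₀ ∧ ∀ n : Fin N, P n u (u n.succ) := by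
  classical
  have hex : ∀ k ≤ N, ∃ u : Fin (N + 1) → X, (∀ n, u n ∈ K) ∧ u 0 = u₀ ∧
      ∀ n : Fin N, (n : ℕ) < k → P n u (u n.succ) := by
    intro k
    induction k with
    | zero => exact fun _ => ⟨fun _ => u₀, fun _ => hu₀, rfl, fun n hn => absurd hn (by simp)⟩
    | succ k ih =>
      intro hk
      obtain ⟨u, huK, hu0, hu⟩ := ih (by omega)
      let m : Fin N := ⟨k, hk⟩
      obtain ⟨x, ⟨hxK, hx⟩, -⟩ := hstep m u huK
      have hlt : ∀ n : Fin N, (n : ℕ) ≤ k → ∀ i ≤ n.castSucc,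
          u i = Function.update u m.succ x i := by
        intro n hn i hi
        rw [Function.update_of_ne]
        rintro rfl
        rw [Fin.le_def] at hi
        simp [m] at hi
        omega
      refine ⟨Function.update u m.succ x, fun n => ?_, ?_, fun n hn => ?_⟩
      · by_cases h : n = m.succ
        · rw [h, Function.update_self]
          exact hxK
        · rw [Function.update_of_ne h]
          exact huK n
      · rw [Function.update_of_ne (Fin.succ_ne_zero m).symm, hu0]
      · refine hcongr n u _ _ (hlt n (by omega)) ?_
        obtain h | h := (Nat.lt_succ_iff_lt_or_eq.1 hn)
        · rw [Function.update_of_ne (fun h' => h.ne (by simpa [m] using congrArg Fin.val h'))]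
          exact hu n h
        · obtain rfl : n = m := Fin.ext h
          rwa [Function.update_self]
  obtain ⟨u, huK, hu0, hu⟩ := hex N le_rfl
  refine ⟨u, ⟨huK, hu0, fun n => hu n n.2⟩, ?_⟩
  rintro w ⟨hwK, hw0, hw⟩
  have heq : ∀ k : ℕ, ∀ i : Fin (N + 1), (i : ℕ) ≤ k → w i = u i := by
    intro k
    induction k with
    | zero =>
      intro i hi
      obtain rfl : i = 0 := Fin.ext (by simpa using hi)
      rw [hw0, hu0]
    | succ k ih =>
      intro i hi
      cases i using Fin.cases with
      | zero => rw [hw0, hu0]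
      | succ n =>
        -- As `w` and `u` agree up to step `n`, both next values solve the same problem.
        refine (hstep n u huK).unique ⟨hwK _, hcongr n w u _ (fun i h => ih i ?_) (hw n)⟩
          ⟨huK _, hu n n.2⟩
        rw [Fin.le_def] at h
        simp at h hi
        omega
  exact funext fun i => heq i i le_rfl

/-- The left-point rule on the last sub-interval keeps the unknown `u n.succ` out of the history
term. -/
theorem discreteHistory_congr {X Y : Type*} [NormedAddCommGroup X] [NormedSpace ℝ X]
    [NormedAddCommGroup Y] [NormedSpace ℝ Y]
    (R : X →L[ℝ] Y) (q : C(ℝ≥0 × ℝ≥0, X →L[ℝ] X)) (aS : X)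
    (T : ℝ≥0) {N : ℕ} {u w : Fin (N + 1) → X} {n : Fin N} (h : ∀ i ≤ n.castSucc, u i = w i) :
    discreteHistory R q aS T N u n = discreteHistory R q aS T N w n := by
  have hs : ∑ i ∈ Finset.Ioo 0 n.succ, q (gridNode T N (n + 1), gridNode T N i) (u i)
      = ∑ i ∈ Finset.Ioo 0 n.succ, q (gridNode T N (n + 1), gridNode T N i) (w i) :=
    Finset.sum_congr rfl fun i hi => by
      rw [h i (Fin.le_castSucc_iff.2 (Finset.mem_Ioo.1 hi).2)]
  simp only [discreteHistory, hs, h 0 (Fin.zero_le _), h _ le_rfl]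

/-- Unique solvability of the first-order semi-discrete scheme, for every starting value in `K`
and every time step, with no smallness condition relating the constants. Only the values of `φ`
on `Y × K × K` matter. -/
theorem mainTheorem10
    {X Xj Y : Type*} [NormedAddCommGroup X] [NormedSpace ℝ X] [CompleteSpace X]
    [NormedAddCommGroup Xj] [NormedSpace ℝ Xj] [CompleteSpace Xj]
    [NormedAddCommGroup Y] [NormedSpace ℝ Y]
    -- the space `X` and the constraint set `K`
    (hX : IsReflexiveSpace X)
    (K : Set X) (hK_closed : IsClosed K) (hK_convex : Convex ℝ K) (hK_zero : (0 : X) ∈ K)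
    -- the operator `γ_j`
    (γ : X →L[ℝ] Xj) (c_j : ℝ) (hc_j : 0 < c_j) (hγ : ∀ v, ‖γ v‖ ≤ c_j * ‖v‖)
    -- the operator `A`
    (A : X → StrongDual ℝ X)
    (L_A : ℝ) (hL_A : 0 < L_A) (hA_lip : ∀ v₁ v₂, ‖A v₁ - A v₂‖ ≤ L_A * ‖v₁ - v₂‖)
    (m_A : ℝ) (hm_A : 0 < m_A)
    (hA_mono : ∀ v₁ v₂, m_A * ‖v₁ - v₂‖ ^ 2 ≤ (A v₁ - A v₂) (v₁ - v₂))
    -- the function `φ`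
    (φ : Y → X → X → ℝ)
    (hφ_convex : ∀ y : Y, ∀ u ∈ K, ConvexOn ℝ K (φ y u))
    (hφ_lsc : ∀ y : Y, ∀ u ∈ K, LowerSemicontinuousOn (φ y u) K)
    (α_φ β_φ : ℝ) (hα_φ : 0 < α_φ) (hβ_φ : 0 < β_φ)
    (hφ : ∀ y₁ y₂ : Y, ∀ u₁ ∈ K, ∀ u₂ ∈ K, ∀ v₁ ∈ K, ∀ v₂ ∈ K,
      φ y₁ u₁ v₂ - φ y₁ u₁ v₁ + φ y₂ u₂ v₁ - φ y₂ u₂ v₂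
        ≤ α_φ * ‖u₁ - u₂‖ * ‖v₁ - v₂‖ + β_φ * ‖y₁ - y₂‖ * ‖v₁ - v₂‖)
    -- the function `j`
    (j : Xj → ℝ) (hj_lip : LocallyLipschitz j)
    (c₀ c₁ : ℝ) (hc₀ : 0 ≤ c₀) (hc₁ : 0 ≤ c₁)
    (hj_growth : ∀ z, ∀ ξ ∈ clarkeSubdiff j z, ‖ξ‖ ≤ c₀ + c₁ * ‖z‖)
    (α_j : ℝ) (hα_j : 0 < α_j)
    (hj_relaxed : ∀ z₁ z₂,
      clarkeDeriv j z₁ (z₂ - z₁) + clarkeDeriv j z₂ (z₁ - z₂) ≤ α_j * ‖z₁ - z₂‖ ^ 2)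
    -- the convexifying operator `j_c`
    (jc : Xj →ₗ[ℝ] StrongDual ℝ Xj) (α_c : ℝ)
    (hjc_bound : ∀ z, ‖jc z‖ ≤ α_c * ‖z‖)
    (hjc_coercive : ∀ z, α_j * ‖z‖ ^ 2 ≤ jc z z)
    -- the right-hand side and the data of the history-dependent operator
    (f : C(ℝ≥0, StrongDual ℝ X))
    (R : X →L[ℝ] Y) (q : C(ℝ≥0 × ℝ≥0, X →L[ℝ] X)) (aS : X)
    -- the time interval, the number of steps, the starting value
    (T : ℝ≥0) (N : ℕ) (hN : 0 < N) (u₀ : X) (hu₀ : u₀ ∈ K) :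
    ∃! u : Fin (N + 1) → X,
      SolvesFirstOrderScheme K A γ φ j jc f R q aS T N u₀ u := by
  have hA : Continuous A :=
    (LipschitzWith.of_dist_le_mul (K := ⟨L_A, hL_A.le⟩) fun v w => by
      rw [dist_eq_norm, dist_eq_norm]
      exact hA_lip v w).continuous
  refine existsUnique_fin_of_step (K := K) (P := fun n u x => ∀ v ∈ K,
      f (gridNode T N (n + 1)) (v - x) + jc (γ (u n.castSucc)) (γ v - γ x)
        ≤ A x (v - x)
          + φ (discreteHistory R q aS T N u n) (u n.castSucc) v
          - φ (discreteHistory R q aS T N u n) (u n.castSucc) x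
          + clarkeDeriv j (γ x) (γ v - γ x)
          + jc (γ x) (γ v - γ x)) ?_ ?_ hu₀
  · intro n u w x h hP
    rwa [discreteHistory_congr R q aS T h, h _ le_rfl] at hP
  · intro n u hu
    have key := hX.existsUnique_variationalHemivariational hK_closed ⟨0, hK_zero⟩ γ hA hm_A hA_mono
      (hφ_convex (discreteHistory R q aS T N u n) _ (hu n.castSucc))
      (hφ_lsc (discreteHistory R q aS T N u n) _ (hu n.castSucc)) hj_lip hj_relaxed
      (jc.mkContinuous α_c hjc_bound) (by simpa using hjc_coercive)
      -- The explicit `jc` term is linear in the test direction and joins the load.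
      (f (gridNode T N (n + 1)) + (jc (γ (u n.castSucc))).comp γ)
    simpa using key
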